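/- Let $\Delta_n$ be the full simplex on $n$ vertices, and for $p\in[0,1]$ let $Y_{n,p}$ be the Linial–Meshulam random complex: each complex $X$ with $\Delta_n^{(1)}\subseteq X\subseteq \Delta_n^{(2)}$ (that is, on $n$ vertices, with complete $1$-skeleton and dimension at most $2$) with $F$ two-dimensional faces has probability $p^{F}(1-p)^{\binom n3-F}$. For a $1$-chain $z$ of $X$ with coefficients in $\mathbb{Z}/2$ put $$\mathrm{Fill}_X(z)=\inf\{\,\|y\| : y\in C_2(X;\mathbb{Z}/2),\ \partial y=z\,\}\in\{0,1,2,\dots\}\cup\{\infty\},$$ where $\|y\|$ is the number of faces in the support of $y$ and $\inf\emptyset=\infty$. For a set $\tau$ of three vertices write $\mathrm{Fill}_X(\tau)$ for $\mathrm{Fill}_X$ of the sum of the three edges of $\tau$ (whether or not $\tau$ is a face of $X$). Then there is a constant $C>0$ such that for every real $\epsilon\le 1$, if $X$ is distributed as $Y_{n,p}$ with $p=n^{\epsilon-1}$, then with probability tending to $1$ as $n\to\infty$, $$\sum_{\tau}\big(\mathrm{Fill}_X(\tau)\big)^2\ \ge\ C\,n^{4-2\epsilon},$$ where the sum runs over all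 $\binom n3$ sets $\tau$ of three vertices. -/

import Mathlib

open Filter Topology
open scoped ENNReal

namespace RandomFill

section Chains

variable {V : Type*} [Fintype V] [DecidableEq V]

/-- The `k`-dimensional faces of an abstract simplicial complex: the faces with `k + 1` vertices. -/
abbrev Face (X : AbstractSimplicialComplex V) (k : ℕ) : Type _ :=
  {s : Finset V // s ∈ X.faces ∧ s.card = k + 1}

noncomputable instance (X : AbstractSimplicialComplex V) (k : ℕ) : Fintype (Face X k) :=
  Fintype.ofFinite _

/-- The `k`-chains of `X` with coefficients in `ℤ/2`. -/
abbrev Chain (X : AbstractSimplicialComplex V) (k : ℕ) : Type _ := Face X k → ZMod 2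

/-- The boundary map `C_{k+1} X → C_k X` over `ℤ/2`: the coefficient of `∂ y` at a `k`-face `e`
is the sum of the coefficients of `y` at the `(k+1)`-faces that contain `e`. -/
noncomputable def boundary (X : AbstractSimplicialComplex V) (k : ℕ) :
    Chain X (k + 1) →ₗ[ZMod 2] Chain X k where
  toFun y := fun e => ∑ s : Face X (k + 1), if e.1 ⊆ s.1 then y s else 0
  map_add' y z := by
    funext e
    simp only [Pi.add_apply, ← Finset.sum_add_distrib]
    refine Finset.sum_congr rfl fun s _ => ?_
    split_ifs <;> simp
  map_smul' c y := by
    funext e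
    simp only [Pi.smul_apply, smul_eq_mul, RingHom.id_apply, Finset.mul_sum]
    refine Finset.sum_congr rfl fun s _ => ?_
    split_ifs <;> simp

/-- `Fill_X z = inf {‖y‖ : ∂ y = z}`, where `‖y‖` is the number of faces in the support of `y`.
It is `⊤` if `z` is not a boundary in `X`. -/
noncomputable def fill (X : AbstractSimplicialComplex V) {k : ℕ} (z : Chain X k) : ℕ∞ :=
  ⨅ (y : Chain X (k + 1)) (_ : boundary X k y = z), (hammingNorm y : ℕ∞)

/-- The triangle spanned by a set `τ` of three vertices, as a `1`-chain: the sum of the edges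
contained in `τ`. -/
def triangleCycle (X : AbstractSimplicialComplex V) (τ : Finset V) : Chain X 1 :=
  fun e => if e.1 ⊆ τ then 1 else 0

end Chains

section LinialMeshulam

/-- The `3`-element subsets of the vertex set `{0, …, n - 1}`. -/
def triangles (n : ℕ) : Finset (Finset (Fin n)) := Finset.univ.powersetCard 3

/-- The complex on `n` vertices with complete `1`-skeleton whose set of `2`-faces is `T`
(for `T ⊆ triangles n`). These are exactly the complexes `X` with `Δ_n^{(1)} ⊆ X ⊆ Δ_n^{(2)}`. -/
def complexOf {n : ℕ} (T : Finset (Finset (Fin n))) : AbstractSimplicialComplex (Fin n) where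
  faces := {s | s.Nonempty ∧ (s.card ≤ 2 ∨ (s.card = 3 ∧ s ∈ T))}
  isRelLowerSet_faces := by
    rintro s ⟨hs, h⟩
    refine ⟨hs, fun t hts ht => ⟨ht, ?_⟩⟩
    have hle := Finset.card_le_card hts
    rcases h with h | ⟨h3, hT⟩
    · exact Or.inl (hle.trans h)
    · by_cases h2 : t.card ≤ 2
      · exact Or.inl h2
      · have hst : t = s := Finset.eq_of_subset_of_card_le hts (by omega)
        subst hst
        exact Or.inr ⟨h3, hT⟩
  singleton_mem v := ⟨Finset.singleton_nonempty v, Or.inl (by simp)⟩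

open Classical in
/-- The probability of the event `A` in the Linial–Meshulam model: the complex with set of
`2`-faces `T` has probability `p ^ F (1 - p) ^ (C(n,3) - F)` with `F = |T|`. -/
noncomputable def lmProb (n : ℕ) (p : ℝ) (A : Set (AbstractSimplicialComplex (Fin n))) : ℝ :=
  ∑ T ∈ (triangles n).powerset with complexOf T ∈ A,
    p ^ T.card * (1 - p) ^ (n.choose 3 - T.card)

/-- `∑_τ Fill_X(τ)^2`, summed over all `C(n,3)` triangles `τ` of the complete `1`-skeleton. -/
noncomputable def sumFillSq {n : ℕ} (X : AbstractSimplicialComplex (Fin n)) : ℝ≥0∞ :=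
  ∑ τ ∈ triangles n, (fill X (triangleCycle X τ) : ℝ≥0∞) ^ 2

end LinialMeshulam

end RandomFill

/-! A typical triangle has no filling smaller than about `n ^ (1/2 - ε) / 6`; squaring this and
summing over order `n ^ 3` triangles gives `n ^ (4 - 2ε)`. The reason is a first moment count of
minimal fillings. Adding `τ` to a minimal filling not containing it gives a minimal 2-cycle, and
such a cycle has few vertices (`IsCycle.two_mul_card_vertices_le`): a filling by `f` triangles uses
at most `K = (f - 1) / 2` vertices off `τ`. Once these are chosen, the filling is built triangle by
triangle, each step joining an edge of wrong parity to one of at most `K + 3` vertices. So there are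
at most `n ^ K * (K + 3) ^ f` candidates (`card_minimalFillings_univ_le`), each present with
probability `p ^ f`. As `K ≤ f / 2 - 1 / 2`, the expected number is at most `n ^ (-1/2) * (n ^ (1/2)
* (K + 3) * p) ^ f`, whose base is at most `1 / 2` for `f` up to the threshold. Summing over `f` and
applying Markov's inequality to the number of triangles with small fillings finishes the proof. When
`ε > 1/2` the threshold rounds up to 1 and no small filling exists. -/

namespace RandomFill

/-! ### Vertex bound for minimal 2-cycles -/

section MinimalCycles

/-- Over `ℤ/2`, a matrix whose kernel contains at most the zero vector and the all-ones vector has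
corank at most one. -/
theorem card_le_rank_add_one {m n : Type*} [Fintype n] (M : Matrix m n (ZMod 2))
    (h : ∀ v : n → ZMod 2, M.mulVec v = 0 → v = 0 ∨ v = 1) : Fintype.card n ≤ M.rank + 1 := by
  have hker : Module.finrank (ZMod 2) (LinearMap.ker M.mulVecLin) ≤ 1 := by
    have hle : LinearMap.ker M.mulVecLin ≤ Submodule.span (ZMod 2) {(1 : n → ZMod 2)} := by
      intro v hv
      rcases h v (by simpa using hv) with rfl | rfl
      · exact Submodule.zero_mem _
      · exact Submodule.mem_span_singleton_self _
    exact (Submodule.finrank_mono hle).trans ((finrank_span_le_card _).trans (by simp))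
  have := LinearMap.finrank_range_add_finrank_ker M.mulVecLin
  rw [Module.finrank_fintype_fun_eq_card] at this
  rw [Matrix.rank]
  omega

variable {α : Type*} [DecidableEq α]

/-- The coefficient at the edge `e` of the boundary of the `2`-chain with support `S`. -/
def edgeParity (S : Finset (Finset α)) (e : Finset α) : ZMod 2 :=
  ∑ s ∈ S, if e ⊆ s then 1 else 0

theorem edgeParity_sdiff {A S : Finset (Finset α)} (h : A ⊆ S) (e : Finset α) :
    edgeParity (S \ A) e = edgeParity S e - edgeParity A e := by
  rw [eq_sub_iff_add_eq]
  exact Finset.sum_sdiff h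

theorem edgeParity_eq_card (S : Finset (Finset α)) (e : Finset α) :
    edgeParity S e = ((S.filter (e ⊆ ·)).card : ZMod 2) := by
  simp [edgeParity]

/-- `S` is the support of a `2`-cycle with coefficients in `ℤ/2`. -/
def IsCycle (S : Finset (Finset α)) : Prop := ∀ e : Finset α, e.card = 2 → edgeParity S e = 0

/-- The edges of the triangles in `T`. -/
def edges (T : Finset (Finset α)) : Finset (Finset α) := T.biUnion (Finset.powersetCard 2)

theorem mem_edges {T : Finset (Finset α)} {e : Finset α} :
    e ∈ edges T ↔ e.card = 2 ∧ ∃ s ∈ T, e ⊆ s := by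
  simp only [edges, Finset.mem_biUnion, Finset.mem_powersetCard]
  tauto

theorem pair_mem_edges {T : Finset (Finset α)} {s : Finset α} (hs : s ∈ T) {a b : α} (ha : a ∈ s)
    (hb : b ∈ s) (hab : a ≠ b) : {a, b} ∈ edges T :=
  mem_edges.2 ⟨Finset.card_pair hab, s, hs, by
    intro x hx
    rcases Finset.mem_insert.1 hx with rfl | hx
    · exact ha
    · rwa [Finset.mem_singleton.1 hx]⟩

/-- Every edge of a cycle lies in at least two triangles. -/
theorem IsCycle.two_mul_card_edges_le {T : Finset (Finset α)} (h3 : ∀ s ∈ T, s.card = 3)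
    (hT : IsCycle T) : 2 * (edges T).card ≤ 3 * T.card := by
  rw [mul_comm 2, mul_comm 3]
  refine Finset.card_mul_le_card_mul (fun e s => e ⊆ s) ?_ ?_
  · intro e he
    obtain ⟨he2, s, hs, hes⟩ := mem_edges.1 he
    have hev : 2 ∣ (T.filter (e ⊆ ·)).card := by
      rw [← ZMod.natCast_eq_zero_iff, ← edgeParity_eq_card]
      exact hT e he2
    have hpos : 0 < (T.filter (e ⊆ ·)).card :=
      Finset.card_pos.2 ⟨s, Finset.mem_filter.2 ⟨hs, hes⟩⟩
    exact Nat.le_of_dvd hpos hev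
  · intro s hs
    have hsub : (Finset.bipartiteBelow (fun e s => e ⊆ s) (edges T) s) ⊆ s.powersetCard 2 := by
      intro e he
      simp only [Finset.mem_bipartiteBelow] at he
      exact Finset.mem_powersetCard.2 ⟨he.2, (mem_edges.1 he.1).1⟩
    refine (Finset.card_le_card hsub).trans ?_
    rw [Finset.card_powersetCard, h3 s hs]
    decide

/-- In a triangle, every vertex lies on an even number of edges. -/
theorem sum_powersetCard_two_mem {s : Finset α} (h3 : s.card = 3) (u : α) :
    ∑ e ∈ s.powersetCard 2, (if u ∈ e then (1 : ZMod 2) else 0) = 0 := by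
  by_cases hu : u ∈ s
  · obtain ⟨s', hus', rfl⟩ : ∃ s', u ∉ s' ∧ insert u s' = s :=
      ⟨s.erase u, Finset.notMem_erase u s, Finset.insert_erase hu⟩
    rw [Finset.card_insert_of_notMem hus'] at h3
    have hs' : s'.card = 2 := by omega
    rw [Finset.sum_ite, Finset.sum_const_zero, add_zero, Finset.sum_const, nsmul_one]
    have : (Finset.powersetCard 2 (insert u s')).filter (u ∈ ·)
        = (s'.powersetCard 1).image (insert u) := by
      rw [Finset.powersetCard_succ_insert hus', Finset.filter_union,
        Finset.filter_false_of_mem, Finset.empty_union, Finset.filter_true_of_mem]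
      · intro e he
        obtain ⟨x, -, rfl⟩ := Finset.mem_image.1 he
        exact Finset.mem_insert_self _ _
      · intro e he hue
        exact hus' ((Finset.mem_powersetCard.1 he).1 hue)
    rw [this, Finset.card_image_of_injOn, Finset.card_powersetCard, hs']
    · decide
    · intro x hx y hy hxy
      have hx' := (Finset.mem_powersetCard.1 hx).1
      have hy' := (Finset.mem_powersetCard.1 hy).1
      rw [← Finset.erase_insert (fun h => hus' (hx' h)),
        ← Finset.erase_insert (fun h => hus' (hy' h)), hxy]
  · refine Finset.sum_eq_zero fun e he => if_neg fun h => hu ((Finset.mem_powersetCard.1 he).1 h)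

/-- An inclusion-minimal nonempty `2`-cycle over `ℤ/2` with `t` triangles has at most `t / 2 + 2`
vertices. -/
theorem IsCycle.two_mul_card_vertices_le {T : Finset (Finset α)} (h3 : ∀ s ∈ T, s.card = 3)
    (hT : IsCycle T) (hmin : ∀ A ⊆ T, IsCycle A → A = ∅ ∨ A = T) :
    2 * (T.biUnion id).card ≤ T.card + 4 := by
  set U := T.biUnion id with hU
  let M₁ : Matrix U (edges T) (ZMod 2) := fun u e => if u.1 ∈ e.1 then 1 else 0
  let M₂ : Matrix (edges T) T (ZMod 2) := fun e s => if e.1 ⊆ s.1 then 1 else 0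
  -- This is `∂ ∘ ∂ = 0` for the incidence matrices of the cycle.
  have hmul : M₁ * M₂ = 0 := by
    ext u s
    rw [Matrix.mul_apply, Matrix.zero_apply, ← sum_powersetCard_two_mem (h3 s.1 s.2) u.1]
    rw [Finset.sum_coe_sort (edges T)
      (fun e => (if u.1 ∈ e then (1 : ZMod 2) else 0) * (if e ⊆ s.1 then 1 else 0))]
    symm
    have hsub : s.1.powersetCard 2 ⊆ edges T := fun e he =>
      mem_edges.2 ⟨(Finset.mem_powersetCard.1 he).2, s.1, s.2, (Finset.mem_powersetCard.1 he).1⟩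
    rw [← Finset.sum_subset hsub]
    · refine Finset.sum_congr rfl fun e he => ?_
      rw [if_pos (Finset.mem_powersetCard.1 he).1, mul_one]
    · intro e he hes
      rw [if_neg fun h => hes (Finset.mem_powersetCard.2 ⟨h, (mem_edges.1 he).1⟩), mul_zero]
  have hrank := Matrix.rank_add_rank_le_card_of_mul_eq_zero hmul
  have h01 : ∀ x : ZMod 2, x = 0 ∨ x = 1 := by decide
  have hr₂ : T.card ≤ M₂.rank + 1 := by
    rw [← Fintype.card_coe T]
    refine card_le_rank_add_one M₂ fun v hv => ?_
    -- A kernel vector of `M₂` is the indicator of a subcycle, so minimality makes it constant.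
    let A := T.filter fun s => ∃ h : s ∈ T, v ⟨s, h⟩ = 1
    have hA : IsCycle A := by
      intro e he
      by_cases heT : e ∈ edges T
      · rw [← show M₂.mulVec v ⟨e, heT⟩ = 0 from congrFun hv _, edgeParity, Finset.sum_filter,
          ← Finset.sum_coe_sort]
        refine Finset.sum_congr rfl fun s _ => ?_
        rcases h01 (v s) with h | h <;> simp [M₂, h]
      · refine Finset.sum_eq_zero fun s hs => if_neg fun hes => heT ?_
        exact mem_edges.2 ⟨he, s, (Finset.mem_filter.1 hs).1, hes⟩
    rcases hmin A (Finset.filter_subset _ _) hA with h | h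
    · left
      funext s
      refine (h01 (v s)).resolve_right fun hs => ?_
      have : s.1 ∈ A := Finset.mem_filter.2 ⟨s.2, s.2, hs⟩
      simp [h] at this
    · right
      funext s
      have : s.1 ∈ A := by rw [h]; exact s.2
      exact (Finset.mem_filter.1 this).2.2
  have hr₁ : U.card ≤ M₁.rank + 1 := by
    rw [← Fintype.card_coe U, ← Matrix.rank_transpose M₁]
    refine card_le_rank_add_one _ fun v hv => ?_
    -- A kernel vector of the transpose of `M₁` agrees at the two ends of every edge, hence is
    -- constant on each triangle.
    let g : α → ZMod 2 := fun u => if h : u ∈ U then v ⟨u, h⟩ else 0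
    have hg : ∀ u : U, g u = v u := fun u => by simp [g]
    have hedge : ∀ s ∈ T, ∀ a ∈ s, ∀ b ∈ s, g a = g b := by
      intro s hs a ha b hb
      by_cases hab : a = b
      · rw [hab]
      have haU : a ∈ U := Finset.mem_biUnion.2 ⟨s, hs, ha⟩
      have hbU : b ∈ U := Finset.mem_biUnion.2 ⟨s, hs, hb⟩
      have h0 : M₁.transpose.mulVec v ⟨{a, b}, pair_mem_edges hs ha hb hab⟩ = 0 :=
        congrFun hv _
      have h1 : ∑ u : U, (if u.1 ∈ ({a, b} : Finset α) then (1 : ZMod 2) else 0) * g u = 0 := by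
        refine Eq.trans ?_ h0
        exact Finset.sum_congr rfl fun u _ => by rw [hg]; rfl
      rw [Finset.sum_coe_sort U
        (fun u => (if u ∈ ({a, b} : Finset α) then (1 : ZMod 2) else 0) * g u)] at h1
      rw [← Finset.sum_subset (s₁ := {a, b}) (by
          intro x hx
          rcases Finset.mem_insert.1 hx with rfl | hx
          · exact haU
          · rwa [Finset.mem_singleton.1 hx]) (by
          intro x _ hx
          rw [if_neg hx, zero_mul]), Finset.sum_pair hab] at h1
      simp only [Finset.mem_insert, Finset.mem_singleton, true_or, or_true, if_true, one_mul] at h1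
      have key : ∀ x y : ZMod 2, x + y = 0 → x = y := by decide
      exact key _ _ h1
    -- All triangles of `T` at a given edge lie in `A` together or not at all, so `A` inherits even
    -- parity; minimality then plays the role of connectedness.
    let A := T.filter fun s => ∀ u ∈ s, g u = 1
    have hA : IsCycle A := by
      intro e he
      obtain ⟨a, b, hab, rfl⟩ := Finset.card_eq_two.1 he
      rcases h01 (g a) with h | h
      · refine Finset.sum_eq_zero fun s hs => if_neg fun hes => ?_
        have := (Finset.mem_filter.1 hs).2 a (hes (by simp))
        rw [h] at this
        exact zero_ne_one this
      · rw [← hT _ he, edgeParity, edgeParity, Finset.sum_filter]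
        refine Finset.sum_congr rfl fun s hs => ?_
        by_cases hes : {a, b} ⊆ s
        · rw [if_pos fun u hu => ?_]
          rw [← h]
          exact hedge s hs u hu a (hes (by simp))
        · simp [hes]
    rcases hmin A (Finset.filter_subset _ _) hA with h | h
    · left
      funext u
      refine (h01 (v u)).resolve_right fun hu => ?_
      obtain ⟨s, hs, hus⟩ := Finset.mem_biUnion.1 u.2
      have : s ∈ A := Finset.mem_filter.2 ⟨hs, fun x hx => by
        rw [hedge s hs x hx u.1 hus, hg, hu]⟩
      simp [h] at this
    · right
      funext u
      obtain ⟨s, hs, hus⟩ := Finset.mem_biUnion.1 u.2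
      have : s ∈ A := h ▸ hs
      rw [← hg]
      exact (Finset.mem_filter.1 this).2 u.1 hus
  -- With `V`, `E`, `t` the numbers of vertices, edges and triangles, `(V - 1) + (t - 1) ≤ E ≤ 3t /
  -- 2`.
  have hE := hT.two_mul_card_edges_le h3
  rw [Fintype.card_coe] at hrank
  omega

end MinimalCycles

/-! ### Structure and number of minimal fillings -/

section Fillings

variable {α : Type*} [DecidableEq α]

/-- `S` is the support of a `2`-chain over `ℤ/2` with boundary the triangle `τ`. -/
def IsFilling (τ : Finset α) (S : Finset (Finset α)) : Prop :=
  (∀ s ∈ S, s.card = 3) ∧ ∀ e : Finset α, e.card = 2 → edgeParity S e = if e ⊆ τ then 1 else 0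

/-- An inclusion-minimal filling with `f` triangles has at most `(f - 1) / 2` vertices off the
filled triangle. -/
theorem two_mul_card_vertices_sdiff_lt {τ : Finset α} (hτ : τ.card = 3) {S : Finset (Finset α)}
    (hS : Minimal (IsFilling τ) S) : 2 * (S.biUnion id \ τ).card < S.card := by
  by_cases hτS : τ ∈ S
  · have hfill : IsFilling τ {τ} := ⟨by simpa using hτ, fun e _ => by rw [edgeParity, Finset.sum_singleton]⟩
    have : S ⊆ {τ} := hS.2 hfill (Finset.singleton_subset_iff.2 hτS)
    obtain rfl : S = {τ} := Finset.Subset.antisymm this (Finset.singleton_subset_iff.2 hτS)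
    simp
  · have hpar : ∀ A : Finset (Finset α), τ ∉ A → ∀ e, edgeParity (insert τ A) e
        = (if e ⊆ τ then 1 else 0) + edgeParity A e := fun A hA e => Finset.sum_insert hA
    have htwo : ∀ x : ZMod 2, x + x = 0 := by decide
    have h3 : ∀ s ∈ insert τ S, s.card = 3 := by
      intro s hs
      rcases Finset.mem_insert.1 hs with rfl | hs
      · exact hτ
      · exact hS.1.1 s hs
    have hcyc : IsCycle (insert τ S) := fun e he => by rw [hpar S hτS, hS.1.2 e he, htwo]
    have key := hcyc.two_mul_card_vertices_le h3 (by
      intro A hA hAc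
      -- A subcycle through `τ` leaves a smaller filling when `τ` is removed; one avoiding `τ` can
      -- be deleted from `S`. Minimality of `S` excludes both unless `A` is everything or empty.
      by_cases hτA : τ ∈ A
      · right
        have hsub : A.erase τ ⊆ S := fun s hs =>
          (Finset.mem_insert.1 (hA (Finset.mem_of_mem_erase hs))).resolve_left
            (Finset.ne_of_mem_erase hs)
        have hfill : IsFilling τ (A.erase τ) := by
          refine ⟨fun s hs => hS.1.1 s (hsub hs), fun e he => ?_⟩
          have h := hpar (A.erase τ) (Finset.notMem_erase τ A) e
          rw [Finset.insert_erase hτA, hAc e he] at h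
          have aux : ∀ x y : ZMod 2, 0 = x + y → y = x := by decide
          exact aux _ _ h
        rw [← Finset.insert_erase hτA, Finset.Subset.antisymm hsub (hS.2 hfill hsub)]
      · left
        have hsub : A ⊆ S := fun s hs =>
          (Finset.mem_insert.1 (hA hs)).resolve_left fun h => hτA (h ▸ hs)
        have hfill : IsFilling τ (S \ A) := by
          refine ⟨fun s hs => hS.1.1 s (Finset.sdiff_subset hs), fun e he => ?_⟩
          rw [edgeParity_sdiff hsub, hAc e he, sub_zero, hS.1.2 e he]
        have hle : S ⊆ S \ A := hS.2 hfill Finset.sdiff_subset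
        refine Finset.eq_empty_of_forall_notMem fun s hs => ?_
        exact (Finset.mem_sdiff.1 (hle (hsub hs))).2 hs)
    -- With `v` vertices off `τ` the cycle bound reads `2 (v + 3) ≤ (|S| + 1) + 4`.
    rw [Finset.biUnion_insert, Finset.card_insert_of_notMem hτS, id, Finset.union_comm,
      ← Finset.sdiff_union_self_eq_union,
      Finset.card_union_of_disjoint Finset.sdiff_disjoint, hτ] at key
    omega

variable [Fintype α]

open Classical in
/-- The minimal fillings of `τ` that consist of `A` and `j` further triangles and have all their
vertices in `W`. -/
noncomputable def minimalFillings (τ W : Finset α) (A : Finset (Finset α)) (j : ℕ) :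
    Finset (Finset (Finset α)) :=
  Finset.univ.filter fun S =>
    Minimal (IsFilling τ) S ∧ A ⊆ S ∧ S.card = A.card + j ∧ ∀ s ∈ S, s ⊆ W

theorem mem_minimalFillings {τ W : Finset α} {A S : Finset (Finset α)} {j : ℕ} :
    S ∈ minimalFillings τ W A j ↔
      Minimal (IsFilling τ) S ∧ A ⊆ S ∧ S.card = A.card + j ∧ ∀ s ∈ S, s ⊆ W := by
  simp [minimalFillings]

/-- A proper part of a minimal filling has an edge with the wrong parity, and one of the missing
triangles is the join of that edge with a vertex of `W`. -/
theorem card_minimalFillings_le (τ W : Finset α) (j : ℕ) (A : Finset (Finset α)) :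
    (minimalFillings τ W A j).card ≤ W.card ^ j := by
  induction j generalizing A with
  | zero =>
    rw [pow_zero, ← Finset.card_singleton A]
    refine Finset.card_le_card fun S hS => ?_
    obtain ⟨-, hAS, hc, -⟩ := mem_minimalFillings.1 hS
    exact Finset.mem_singleton.2 (Finset.eq_of_subset_of_card_le hAS hc.le).symm
  | succ j ih =>
    by_cases hex : ∃ e : Finset α, e.card = 2 ∧ edgeParity A e ≠ if e ⊆ τ then 1 else 0
    · obtain ⟨e, he, hne⟩ := hex
      have hsub : minimalFillings τ W A (j + 1)
          ⊆ W.biUnion fun w => minimalFillings τ W (insert (insert w e) A) j := by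
        intro S hS
        obtain ⟨hmin, hAS, hc, hW⟩ := mem_minimalFillings.1 hS
        have hpar : edgeParity (S \ A) e ≠ 0 := by
          rw [edgeParity_sdiff hAS, hmin.1.2 e he, sub_ne_zero]
          exact hne.symm
        obtain ⟨s, hs, hs0⟩ := Finset.exists_ne_zero_of_sum_ne_zero hpar
        have hes : e ⊆ s := by
          by_contra h
          exact hs0 (if_neg h)
        obtain ⟨hsS, hsA⟩ := Finset.mem_sdiff.1 hs
        have hs3 := hmin.1.1 s hsS
        obtain ⟨w, hw⟩ := Finset.card_eq_one.1
          (show (s \ e).card = 1 by rw [Finset.card_sdiff_of_subset hes]; omega)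
        have hsw : insert w e = s := by
          rw [Finset.insert_eq, ← hw, Finset.sdiff_union_of_subset hes]
        refine Finset.mem_biUnion.2 ⟨w, hW s hsS (hsw ▸ Finset.mem_insert_self w e), ?_⟩
        rw [hsw]
        refine mem_minimalFillings.2 ⟨hmin, Finset.insert_subset hsS hAS, ?_, hW⟩
        rw [Finset.card_insert_of_notMem hsA]
        omega
      refine (Finset.card_le_card hsub).trans ?_
      rw [pow_succ']
      exact Finset.card_biUnion_le_card_mul _ _ _ fun w _ => ih _
    -- With no wrong edge, `A` is already a filling, so no minimal filling properly contains it.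
    · push Not at hex
      rw [Finset.eq_empty_of_forall_notMem (s := minimalFillings τ W A (j + 1)) fun S hS => ?_]
      · simp
      · obtain ⟨hmin, hAS, hc, -⟩ := mem_minimalFillings.1 hS
        have hA : IsFilling τ A := ⟨fun s hs => hmin.1.1 s (hAS hs), hex⟩
        have := Finset.card_le_card (hmin.2 hA hAS)
        omega

/-- The number of minimal fillings of a triangle by `f` triangles. -/
theorem card_minimalFillings_univ_le {τ : Finset α} (hτ : τ.card = 3) (f : ℕ) :
    (minimalFillings τ Finset.univ ∅ f).card
      ≤ Fintype.card α ^ ((f - 1) / 2) * ((f - 1) / 2 + 3) ^ f := by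
  set K := (f - 1) / 2 with hK
  have hsub : minimalFillings τ Finset.univ ∅ f ⊆ (Finset.univ : Finset (Fin K → α)).biUnion
      fun g => minimalFillings τ (τ ∪ Finset.univ.image g) ∅ f := by
    intro S hS
    obtain ⟨hmin, -, hc, -⟩ := mem_minimalFillings.1 hS
    have hV := two_mul_card_vertices_sdiff_lt hτ hmin
    rw [Finset.card_empty, zero_add] at hc
    obtain ⟨ι⟩ := Function.Embedding.nonempty_of_card_le
      (show Fintype.card ↥(S.biUnion id \ τ) ≤ Fintype.card (Fin K) by
        rw [Fintype.card_coe, Fintype.card_fin]; omega)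
    obtain ⟨a, -⟩ := Finset.card_pos.1 (show 0 < τ.card by omega)
    -- The function `g` lists the vertices off `τ`; spare slots repeat a vertex of `τ`, which adds
    -- nothing to `W`.
    refine Finset.mem_biUnion.2
      ⟨Function.extend ι Subtype.val fun _ => a, Finset.mem_univ _, ?_⟩
    refine mem_minimalFillings.2 ⟨hmin, Finset.empty_subset _, by simpa using hc, ?_⟩
    intro s hs x hx
    by_cases hxτ : x ∈ τ
    · exact Finset.mem_union_left _ hxτ
    · have hxV : x ∈ S.biUnion id \ τ :=
        Finset.mem_sdiff.2 ⟨Finset.mem_biUnion.2 ⟨s, hs, hx⟩, hxτ⟩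
      refine Finset.mem_union_right _ (Finset.mem_image.2 ⟨ι ⟨x, hxV⟩, Finset.mem_univ _, ?_⟩)
      exact ι.injective.extend_apply _ _ _
  refine (Finset.card_le_card hsub).trans ((Finset.card_biUnion_le_card_mul _ _ _ fun g _ =>
    (card_minimalFillings_le τ _ f ∅).trans (Nat.pow_le_pow_left (m := K + 3) ?_ f)).trans ?_)
  · refine (Finset.card_union_le _ _).trans ?_
    have := Finset.card_image_le (s := Finset.univ) (f := g)
    rw [Finset.card_univ, Fintype.card_fin] at this
    omega
  · rw [Finset.card_univ, Fintype.card_fun, Fintype.card_fin]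

end Fillings

/-! ### From chains of the complex to minimal fillings -/

section FillingsInComplex

variable {n : ℕ}

/-- The support of a chain attaining the bound is a filling, and passing to an inclusion-minimal one
inside it only lowers the size. -/
theorem exists_minimal_filling_of_fill_lt {T : Finset (Finset (Fin n))} {τ : Finset (Fin n)} {k : ℕ}
    (h : fill (complexOf T) (triangleCycle (complexOf T) τ) < k) :
    ∃ S ⊆ T, Minimal (IsFilling τ) S ∧ S.card < k := by
  obtain ⟨y, hy⟩ := iInf_lt_iff.1 h
  obtain ⟨hb, hy⟩ := iInf_lt_iff.1 hy
  rw [Nat.cast_lt] at hy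
  have h01 : ∀ x : ZMod 2, x = 0 ∨ x = 1 := by decide
  let S : Finset (Finset (Fin n)) :=
    (Finset.univ.filter fun s => y s ≠ 0).map (Function.Embedding.subtype _)
  have hST : S ⊆ T := by
    intro s hs
    obtain ⟨s', -, rfl⟩ := Finset.mem_map.1 hs
    have h1 := s'.2.2
    have h2 : s'.1.card ≤ 2 ∨ (s'.1.card = 3 ∧ s'.1 ∈ T) := s'.2.1.2
    exact (h2.resolve_left (by omega)).2
  have hS : IsFilling τ S := by
    refine ⟨fun s hs => ?_, fun e he => ?_⟩
    · obtain ⟨s', -, rfl⟩ := Finset.mem_map.1 hs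
      exact s'.2.2
    · have hface : e ∈ (complexOf T).faces :=
        ⟨Finset.card_pos.1 (by omega), Or.inl he.le⟩
      have hbe := congrFun hb ⟨e, hface, he⟩
      simp only [triangleCycle] at hbe
      rw [← hbe, edgeParity, Finset.sum_map, Finset.sum_filter]
      refine Finset.sum_congr rfl fun s _ => ?_
      by_cases hes : e ⊆ s.1 <;> rcases h01 (y s) with h | h <;> simp [h, hes]
  obtain ⟨S', hS', hmin⟩ := exists_minimal_le_of_wellFoundedLT (IsFilling τ) S hS
  refine ⟨S', Finset.Subset.trans hS' hST, hmin, (Finset.card_le_card hS').trans_lt ?_⟩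
  rw [Finset.card_map]
  exact hy

end FillingsInComplex

/-! ### Union bound in the random complex -/

section Probability

theorem sum_biUnion_le {ι β : Type*} [DecidableEq β] {s : Finset ι} {t : ι → Finset β}
    {w : β → ℝ} (hw : ∀ b, 0 ≤ w b) :
    ∑ b ∈ s.biUnion t, w b ≤ ∑ i ∈ s, ∑ b ∈ t i, w b := by
  classical
  induction s using Finset.induction_on with
  | empty => simp
  | insert i s hi ih =>
    rw [Finset.biUnion_insert, Finset.sum_insert hi]
    have := Finset.sum_union_inter (s₁ := t i) (s₂ := s.biUnion t) (f := w)
    have := Finset.sum_nonneg fun b (_ : b ∈ t i ∩ s.biUnion t) => hw b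
    linarith

variable {n : ℕ} {p : ℝ}

/-- The probability of the complex with set of `2`-faces `T`. -/
noncomputable def weight (n : ℕ) (p : ℝ) (T : Finset (Finset (Fin n))) : ℝ :=
  p ^ T.card * (1 - p) ^ (n.choose 3 - T.card)

theorem weight_nonneg (h0 : 0 ≤ p) (h1 : p ≤ 1) (T : Finset (Finset (Fin n))) :
    0 ≤ weight n p T :=
  mul_nonneg (pow_nonneg h0 _) (pow_nonneg (sub_nonneg.2 h1) _)

theorem card_triangles (n : ℕ) : (triangles n).card = n.choose 3 := by
  simp [triangles]

/-- A given set of triangles is contained in the random complex with probability `p ^ |S|`. -/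
theorem sum_weight_superset {S : Finset (Finset (Fin n))} (hS : S ⊆ triangles n) :
    ∑ T ∈ (triangles n).powerset with S ⊆ T, weight n p T = p ^ S.card := by
  have hcard : (triangles n \ S).card = n.choose 3 - S.card := by
    rw [Finset.card_sdiff_of_subset hS, card_triangles]
  have h := Finset.sum_pow_mul_eq_add_pow p (1 - p) (triangles n \ S)
  rw [add_sub_cancel, one_pow] at h
  rw [← mul_one (p ^ S.card), ← h, Finset.mul_sum]
  -- Supersets of `S` correspond to subsets of the complement, over which the binomial weights sum
  -- to 1.
  refine Finset.sum_nbij' (· \ S) (S ∪ ·) ?_ ?_ ?_ ?_ ?_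
  · intro T hT
    obtain ⟨hT, -⟩ := Finset.mem_filter.1 hT
    exact Finset.mem_powerset.2 (Finset.sdiff_subset_sdiff (Finset.mem_powerset.1 hT) le_rfl)
  · intro T hT
    have hT := Finset.mem_powerset.1 hT
    exact Finset.mem_filter.2 ⟨Finset.mem_powerset.2
      (Finset.union_subset hS (hT.trans Finset.sdiff_subset)), Finset.subset_union_left⟩
  · intro T hT
    exact Finset.union_sdiff_of_subset (Finset.mem_filter.1 hT).2
  · intro T hT
    have hT := Finset.mem_powerset.1 hT
    exact Finset.union_sdiff_cancel_left
      (Finset.disjoint_sdiff.mono_right hT)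
  · intro T hT
    have hST := (Finset.mem_filter.1 hT).2
    have hle := Finset.card_le_card hST
    rw [weight, ← mul_assoc, ← pow_add, hcard, Finset.card_sdiff_of_subset hST]
    congr 2 <;> omega

theorem sum_weight (n : ℕ) (p : ℝ) : ∑ T ∈ (triangles n).powerset, weight n p T = 1 := by
  simpa using sum_weight_superset (p := p) (Finset.empty_subset (triangles n))

theorem IsFilling.subset_triangles {τ : Finset (Fin n)} {S : Finset (Finset (Fin n))}
    (h : IsFilling τ S) : S ⊆ triangles n := fun s hs =>
  Finset.mem_powersetCard.2 ⟨Finset.subset_univ s, h.1 s hs⟩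

open Classical in
/-- Union bound over the minimal fillings of `τ`. -/
theorem sum_weight_fill_lt_le (h0 : 0 ≤ p) (h1 : p ≤ 1) {τ : Finset (Fin n)} (hτ : τ.card = 3)
    (k : ℕ) :
    ∑ T ∈ (triangles n).powerset with fill (complexOf T) (triangleCycle (complexOf T) τ) < k,
        weight n p T
      ≤ ∑ f ∈ Finset.Ico 1 k, (n : ℝ) ^ ((f - 1) / 2) * (((f - 1) / 2 : ℕ) + 3 : ℝ) ^ f * p ^ f := by
  set F := fun f => minimalFillings τ Finset.univ ∅ f
  have hsub : ((triangles n).powerset.filter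
        fun T => fill (complexOf T) (triangleCycle (complexOf T) τ) < k)
      ⊆ (Finset.Ico 1 k).biUnion fun f => (F f).biUnion fun S =>
        (triangles n).powerset.filter (S ⊆ ·) := by
    intro T hT
    obtain ⟨hT, hfill⟩ := Finset.mem_filter.1 hT
    obtain ⟨S, hST, hmin, hc⟩ := exists_minimal_filling_of_fill_lt hfill
    have hpos := two_mul_card_vertices_sdiff_lt hτ hmin
    refine Finset.mem_biUnion.2 ⟨S.card, Finset.mem_Ico.2 ⟨by omega, hc⟩, ?_⟩
    refine Finset.mem_biUnion.2 ⟨S, mem_minimalFillings.2 ⟨hmin, Finset.empty_subset _, by simp,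
      fun s _ => Finset.subset_univ s⟩, Finset.mem_filter.2 ⟨hT, hST⟩⟩
  have hw := weight_nonneg (n := n) h0 h1
  refine (Finset.sum_le_sum_of_subset_of_nonneg hsub fun T _ _ => hw T).trans ?_
  refine (sum_biUnion_le hw).trans ?_
  refine Finset.sum_le_sum fun f hf => ?_
  refine (sum_biUnion_le hw).trans ?_
  have hS : ∀ S ∈ F f, ∑ T ∈ (triangles n).powerset with S ⊆ T, weight n p T = p ^ f := by
    intro S hS
    obtain ⟨hmin, -, hc, -⟩ := mem_minimalFillings.1 hS
    rw [sum_weight_superset hmin.1.subset_triangles, hc, Finset.card_empty, zero_add]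
  rw [Finset.sum_congr rfl hS, Finset.sum_const, nsmul_eq_mul]
  refine mul_le_mul_of_nonneg_right ?_ (pow_nonneg h0 f)
  have := card_minimalFillings_univ_le hτ f
  rw [Fintype.card_fin] at this
  exact_mod_cast this

end Probability

/-! ### Threshold estimates and Markov's inequality -/

section Estimates

/-- The spare factor `n ^ (-1/2)` comes from the `-1` in `(f - 1) / 2`; it is what makes the failure
probability tend to 0. -/
theorem filling_term_le {n : ℕ} (hn : 1 ≤ n) {ε : ℝ} {f : ℕ} (hf : 1 ≤ f)
    (hfk : (f : ℝ) ≤ (n : ℝ) ^ (1 / 2 - ε) / 6) :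
    (n : ℝ) ^ ((f - 1) / 2) * (((f - 1) / 2 : ℕ) + 3 : ℝ) ^ f * ((n : ℝ) ^ (ε - 1)) ^ f
      ≤ (n : ℝ) ^ (-(1 / 2) : ℝ) * (1 / 2) ^ f := by
  have hn1 : (1 : ℝ) ≤ n := by exact_mod_cast hn
  have hn0 : (0 : ℝ) < n := by linarith
  have hf1 : (1 : ℝ) ≤ f := by exact_mod_cast hf
  set K := (f - 1) / 2 with hK
  have hK' : (2 * K + 1 : ℝ) ≤ f := by
    have : 2 * K + 1 ≤ f := by omega
    exact_mod_cast this
  have h1 : (n : ℝ) ^ K ≤ (n : ℝ) ^ (-(1 / 2) : ℝ) * ((n : ℝ) ^ (1 / 2 : ℝ)) ^ f := by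
    rw [← Real.rpow_natCast, ← Real.rpow_natCast, ← Real.rpow_mul hn0.le, ← Real.rpow_add hn0]
    exact Real.rpow_le_rpow_of_exponent_le hn1 (by linarith)
  have h2 : (n : ℝ) ^ (1 / 2 : ℝ) * (K + 3) * (n : ℝ) ^ (ε - 1) ≤ 1 / 2 := by
    have hpow : (n : ℝ) ^ (1 / 2 : ℝ) * (n : ℝ) ^ (ε - 1) * (n : ℝ) ^ (1 / 2 - ε) = 1 := by
      rw [← Real.rpow_add hn0, ← Real.rpow_add hn0, ← Real.rpow_zero (n : ℝ)]
      congr 1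
      ring
    -- Since `2K + 1 ≤ f` and `1 ≤ f`, `K + 3 ≤ 3f`; this is where the divisor 6 in the threshold is
    -- used.
    have hK3 : (K + 3 : ℝ) ≤ (n : ℝ) ^ (1 / 2 - ε) / 2 := by linarith
    have hpos : 0 ≤ (n : ℝ) ^ (1 / 2 : ℝ) * (n : ℝ) ^ (ε - 1) := by positivity
    nlinarith [mul_le_mul_of_nonneg_left hK3 hpos]
  calc (n : ℝ) ^ K * (K + 3 : ℝ) ^ f * ((n : ℝ) ^ (ε - 1)) ^ f
      ≤ (n : ℝ) ^ (-(1 / 2) : ℝ) * ((n : ℝ) ^ (1 / 2 : ℝ)) ^ f * (K + 3 : ℝ) ^ f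
          * ((n : ℝ) ^ (ε - 1)) ^ f := by gcongr
    _ = (n : ℝ) ^ (-(1 / 2) : ℝ)
          * ((n : ℝ) ^ (1 / 2 : ℝ) * (K + 3) * (n : ℝ) ^ (ε - 1)) ^ f := by
        rw [mul_pow, mul_pow]; ring
    _ ≤ (n : ℝ) ^ (-(1 / 2) : ℝ) * (1 / 2) ^ f := by gcongr

open Classical in
/-- A fixed triangle has a filling of size below `n ^ (1 / 2 - ε) / 6` with probability at most
`n ^ (-1 / 2)`. -/
theorem sum_weight_fill_lt_ceil_le {n : ℕ} (hn : 1 ≤ n) {ε : ℝ} (hε : ε ≤ 1) {τ : Finset (Fin n)}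
    (hτ : τ.card = 3) :
    ∑ T ∈ (triangles n).powerset with fill (complexOf T) (triangleCycle (complexOf T) τ)
          < (⌈(n : ℝ) ^ (1 / 2 - ε) / 6⌉₊ : ℕ), weight n ((n : ℝ) ^ (ε - 1)) T
      ≤ (n : ℝ) ^ (-(1 / 2) : ℝ) := by
  have hn1 : (1 : ℝ) ≤ n := by exact_mod_cast hn
  refine (sum_weight_fill_lt_le (by positivity)
    (Real.rpow_le_one_of_one_le_of_nonpos hn1 (by linarith)) hτ _).trans ?_
  refine (Finset.sum_le_sum fun f hf => filling_term_le hn (Finset.mem_Ico.1 hf).1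
    (Nat.lt_ceil.1 (Finset.mem_Ico.1 hf).2).le).trans ?_
  rw [← Finset.mul_sum]
  refine mul_le_of_le_one_right (by positivity) ?_
  have hgeom : HasSum (fun f : ℕ => (1 / 2 : ℝ) ^ (f + 1)) 1 := by
    simpa [pow_succ] using hasSum_geometric_two.mul_right (1 / 2 : ℝ)
  rw [Finset.sum_Ico_eq_sum_range]
  simp only [add_comm 1]
  exact sum_le_hasSum _ (fun _ _ => by positivity) hgeom

theorem cube_div_le_choose_three {n : ℕ} (hn : 3 ≤ n) : (n : ℝ) ^ 3 / 27 ≤ (n.choose 3 : ℕ) := by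
  obtain ⟨m, rfl⟩ := Nat.exists_eq_add_of_le' hn
  have h : ((m + 3).choose 3 * 6 : ℕ) = (m + 3) * (m + 2) * (m + 1) := by
    have := Nat.descFactorial_eq_factorial_mul_choose (m + 3) 3
    simp [Nat.descFactorial, Nat.factorial] at this
    linarith
  have h' : (((m + 3).choose 3 : ℕ) : ℝ) * 6 = (m + 3) * (m + 2) * (m + 1) := by exact_mod_cast h
  have hm : (0 : ℝ) ≤ m := Nat.cast_nonneg m
  push_cast
  nlinarith [mul_nonneg hm hm, mul_nonneg hm (mul_nonneg hm hm)]

open Classical in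
/-- If at most half of the triangles have small fillings, then the sum of squares is large. -/
theorem le_sumFillSq {n : ℕ} (hn : 3 ≤ n) {ε : ℝ} (X : AbstractSimplicialComplex (Fin n))
    (h : 2 * ((triangles n).filter fun τ => fill X (triangleCycle X τ)
          < (⌈(n : ℝ) ^ (1 / 2 - ε) / 6⌉₊ : ℕ)).card ≤ n.choose 3) :
    ENNReal.ofReal (1 / 1944 * (n : ℝ) ^ (4 - 2 * ε)) ≤ sumFillSq X := by
  set k := ⌈(n : ℝ) ^ (1 / 2 - ε) / 6⌉₊ with hk
  set G := (triangles n).filter fun τ => ¬ fill X (triangleCycle X τ) < k with hG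
  have hn0 : (0 : ℝ) < n := by
    have : 0 < n := by omega
    exact_mod_cast this
  have hcard : n.choose 3 ≤ 2 * G.card := by
    have : ((triangles n).filter fun τ => fill X (triangleCycle X τ) < k).card + G.card
        = (triangles n).card := by
      convert Finset.card_filter_add_card_filter_not (s := triangles n)
        (fun τ => fill X (triangleCycle X τ) < k)
    rw [card_triangles] at this
    omega
  have hsum : (G.card : ℝ≥0∞) * (k : ℝ≥0∞) ^ 2 ≤ sumFillSq X := by
    rw [← nsmul_eq_mul, ← Finset.sum_const]
    refine (Finset.sum_le_sum fun τ hτ => ?_).trans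
      (Finset.sum_le_sum_of_subset (Finset.filter_subset _ _))
    have hle : (k : ℕ∞) ≤ fill X (triangleCycle X τ) := not_lt.1 (Finset.mem_filter.1 hτ).2
    gcongr
    exact_mod_cast ENat.toENNReal_le.2 hle
  refine le_trans ?_ hsum
  rw [← ENNReal.ofReal_natCast, ← ENNReal.ofReal_natCast, ← ENNReal.ofReal_pow (by positivity),
    ← ENNReal.ofReal_mul (by positivity)]
  refine ENNReal.ofReal_le_ofReal ?_
  have hk' : (n : ℝ) ^ (1 / 2 - ε) / 6 ≤ k := Nat.le_ceil _
  have hG' : (n : ℝ) ^ 3 / 54 ≤ G.card := by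
    have h1 := cube_div_le_choose_three hn
    have h2 : ((n.choose 3 : ℕ) : ℝ) ≤ 2 * G.card := by exact_mod_cast hcard
    linarith
  -- The constant is `1944 = 54 * 6 ^ 2`.
  calc 1 / 1944 * (n : ℝ) ^ (4 - 2 * ε)
      = (n : ℝ) ^ 3 / 54 * ((n : ℝ) ^ (1 / 2 - ε) / 6) ^ 2 := by
        rw [div_pow, ← Real.rpow_natCast, ← Real.rpow_natCast, ← Real.rpow_mul hn0.le,
          show (4 - 2 * ε) = ((3 : ℕ) : ℝ) + (1 / 2 - ε) * ((2 : ℕ) : ℝ) by push_cast; ring,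
          Real.rpow_add hn0]
        ring
    _ ≤ G.card * (k : ℝ) ^ 2 := by gcongr

open Classical in
/-- The event fails with probability at most `2 n ^ (-1 / 2)`, by Markov's inequality for the number
of triangles with small fillings. -/
theorem one_sub_le_lmProb {n : ℕ} (hn : 3 ≤ n) {ε : ℝ} (hε : ε ≤ 1) :
    1 - 2 * (n : ℝ) ^ (-(1 / 2) : ℝ) ≤ lmProb n ((n : ℝ) ^ (ε - 1))
      {X | ENNReal.ofReal (1 / 1944 * (n : ℝ) ^ (4 - 2 * ε)) ≤ sumFillSq X} := by
  set p := (n : ℝ) ^ (ε - 1) with hp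
  set k := ⌈(n : ℝ) ^ (1 / 2 - ε) / 6⌉₊ with hk
  obtain ⟨A, hA⟩ : ∃ A : Set (AbstractSimplicialComplex (Fin n)),
      A = {X | ENNReal.ofReal (1 / 1944 * (n : ℝ) ^ (4 - 2 * ε)) ≤ sumFillSq X} := ⟨_, rfl⟩
  rw [← hA]
  have hn1 : (1 : ℝ) ≤ n := by exact_mod_cast (show 1 ≤ n by omega)
  have hw := weight_nonneg (n := n) (p := p) (by positivity)
    (Real.rpow_le_one_of_one_le_of_nonpos hn1 (by linarith))
  have hsplit : lmProb n p A
      + ∑ T ∈ (triangles n).powerset with complexOf T ∉ A, weight n p T = 1 := by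
    rw [← sum_weight n p]
    exact Finset.sum_filter_add_sum_filter_not _ _ _
  let small : Finset (Finset (Fin n)) → Finset (Finset (Fin n)) := fun T =>
    (triangles n).filter fun τ => fill (complexOf T) (triangleCycle (complexOf T) τ) < k
  have hsmall : ∑ T ∈ (triangles n).powerset, weight n p T * (small T).card
      ≤ n.choose 3 * (n : ℝ) ^ (-(1 / 2) : ℝ) := by
    have hcard : ∀ T, weight n p T * (small T).card = ∑ τ ∈ triangles n,
        if fill (complexOf T) (triangleCycle (complexOf T) τ) < k then weight n p T else 0 := by
      intro T
      rw [← Finset.sum_filter, Finset.sum_const, nsmul_eq_mul, mul_comm]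
    simp only [hcard]
    rw [Finset.sum_comm, ← card_triangles, ← nsmul_eq_mul, ← Finset.sum_const]
    refine Finset.sum_le_sum fun τ hτ => ?_
    rw [← Finset.sum_filter]
    exact sum_weight_fill_lt_ceil_le (by omega) hε (Finset.mem_powersetCard.1 hτ).2
  have hbad : n.choose 3 * ∑ T ∈ (triangles n).powerset with complexOf T ∉ A, weight n p T
      ≤ 2 * ∑ T ∈ (triangles n).powerset, weight n p T * (small T).card := by
    rw [Finset.mul_sum, Finset.mul_sum]
    refine (Finset.sum_le_sum fun T hT => ?_).trans (Finset.sum_le_sum_of_subset_of_nonneg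
      (Finset.filter_subset _ _) fun T _ _ => by have := hw T; positivity)
    have hle : n.choose 3 ≤ 2 * (small T).card := by
      by_contra hlt
      refine (Finset.mem_filter.1 hT).2 ?_
      rw [hA]
      exact le_sumFillSq hn _ (not_le.1 hlt).le
    have hle' : ((n.choose 3 : ℕ) : ℝ) ≤ 2 * (small T).card := by exact_mod_cast hle
    nlinarith [mul_le_mul_of_nonneg_left hle' (hw T)]
  have hpos : (0 : ℝ) < (n.choose 3 : ℕ) := by exact_mod_cast Nat.choose_pos hn
  have : ∑ T ∈ (triangles n).powerset with complexOf T ∉ A, weight n p T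
      ≤ 2 * (n : ℝ) ^ (-(1 / 2) : ℝ) := by
    refine le_of_mul_le_mul_left ?_ hpos
    linarith
  linarith

theorem lmProb_le_one {n : ℕ} {p : ℝ} (h0 : 0 ≤ p) (h1 : p ≤ 1)
    (A : Set (AbstractSimplicialComplex (Fin n))) : lmProb n p A ≤ 1 := by
  classical
  rw [← sum_weight n p]
  exact Finset.sum_le_sum_of_subset_of_nonneg (Finset.filter_subset _ _)
    fun T _ _ => weight_nonneg h0 h1 T

end Estimates

end RandomFill

theorem proposition4p2 :
    ∃ C : ℝ, 0 < C ∧ ∀ ε : ℝ, ε ≤ 1 →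
      Tendsto
        (fun n : ℕ => RandomFill.lmProb n ((n : ℝ) ^ (ε - 1))
          {X | ENNReal.ofReal (C * (n : ℝ) ^ (4 - 2 * ε)) ≤ RandomFill.sumFillSq X})
        atTop (𝓝 1) := by
  refine ⟨1 / 1944, by norm_num, fun ε hε => ?_⟩
  have hlim : Tendsto (fun n : ℕ => 1 - 2 * (n : ℝ) ^ (-(1 / 2) : ℝ)) atTop (𝓝 1) := by
    have h := (tendsto_rpow_neg_atTop (show (0 : ℝ) < 1 / 2 by norm_num)).comp
      tendsto_natCast_atTop_atTop
    simpa using (h.const_mul 2).const_sub 1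
  refine tendsto_of_tendsto_of_tendsto_of_le_of_le' hlim tendsto_const_nhds ?_ ?_
  · filter_upwards [eventually_ge_atTop 3] with n hn
    exact RandomFill.one_sub_le_lmProb hn hε
  · filter_upwards [eventually_ge_atTop 1] with n hn
    exact RandomFill.lmProb_le_one (by positivity)
      (Real.rpow_le_one_of_one_le_of_nonpos (by exact_mod_cast hn) (by linarith)) _
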